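/- For $n\ge 1$ let $O^{*}(n)$ be the weighted number of partitions of $n$ into odd parts such that (i) if a number appears as a part, then all smaller positive odd numbers appear as parts as well, and (ii) the largest part appears an odd number of times, where a partition is counted with weight $-1$ if its largest part is congruent to $1 \pmod 4$ and with weight $+1$ if its largest part is congruent to $3 \pmod 4$. Let $L=\mathbb{Q}(\sqrt{2})$, let $O_L$ be its ring of integers, and for an ideal $\mathfrak{a}\subset O_L$ let $N(\mathfrak{a})$ be its norm. Then, as formal Laurent series in $q$ with integer coefficients (both infinite sums being convergent coefficientwise), $$2q^{-1}\sum_{n\ge1}O^{*}(n)q^{8n}=\sum_{\substack{\mathfrak{a}\subset O_L \\ N(\mathfrak{a})\equiv-1\ (\mathrm{mod}\ 8)}}(-1)^{\frac{N(\mathfrak{a})+1}{8}}q^{N(\mathfrak{a})}.$$ -/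

import Mathlib

open scoped IntermediateField NumberField PowerSeries LaurentSeries PowerSeries.WithPiTopology

/-- The partitions `p` into odd parts such that, whenever a number appears as a part, every smaller
(positive) odd number appears as a part as well, and such that the largest part appears an odd
number of times. -/
def IsOStarPartition {n : ℕ} (p : n.Partition) : Prop :=
  (∀ i ∈ p.parts, Odd i) ∧
  (∀ i ∈ p.parts, ∀ j < i, Odd j → j ∈ p.parts) ∧
  Odd (p.parts.count p.parts.sup)

/-- `-1` if the largest part is congruent to `1` mod `4`, and `+1` otherwise, i.e. if the largest
part is congruent to `3` mod `4` when all the parts are odd. -/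
def oWeight {n : ℕ} (p : n.Partition) : ℤ :=
  if p.parts.sup % 4 = 1 then -1 else 1

open Classical in
/-- The number `O*(n)`: the partitions of `n` above, counted with their weights. -/
noncomputable def OStar (n : ℕ) : ℤ :=
  ∑ p : n.Partition with IsOStarPartition p, oWeight p

/-- The field `ℚ(√2)`. -/
noncomputable abbrev QSqrtTwo : IntermediateField ℚ ℝ := ℚ⟮√(2 : ℝ)⟯

instance : NumberField QSqrtTwo where
  to_charZero := inferInstance
  to_finiteDimensional := by
    refine IntermediateField.adjoin.finiteDimensional ?_
    refine ⟨Polynomial.X ^ 2 - Polynomial.C 2, Polynomial.monic_X_pow_sub_C 2 two_ne_zero, ?_⟩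
    simp

/-- The ideals of the ring of integers of `ℚ(√2)` whose norm is congruent to `-1` mod `8`. -/
abbrev NormNegOneIdeal : Type :=
  {a : Ideal (𝓞 QSqrtTwo) // (Ideal.absNorm a : ℤ) ≡ -1 [ZMOD 8]}

/-! Grouping the partitions by their largest part `2 n + 1` writes the generating function of `O*`
as `∑ (-1) ^ (n + 1) q ^ ((n + 1) ^ 2) / ((q; q²)ₙ (1 - q ^ (4 n + 2)))`. The evaluation of the
Rogers–Szegő polynomials in base `q²` at `q`, combined with a telescoping sum of Bailey type,
expands each denominator as a double sum. Exchanging the order of summation, the innermost sum is a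
limiting case of the Gauss `₂φ₁` summation, and what remains is the indefinite theta series
`∑ (-1) ^ n (q ^ (2 n ^ 2 - n - k (k + 1)) + q ^ (2 n ^ 2 + n - k (k + 1)))` over `0 ≤ k < n`.

With `x = 4 n ∓ 1` and `y = 2 k + 1`, the exponents `e` satisfy `x ^ 2 - 2 y ^ 2 = 8 e - 1` and
`e ≡ n mod 2`. Up to the sign `(-1) ^ e`, the theta series therefore counts the elements of norm
`8 e - 1` in the half `y > 0` of the domain `2 |y| < x`. That domain is a fundamental domain for the
units `±(1 + √2)ᵏ` acting on the elements of odd norm, and every ideal of `ℤ[√2]` is principal, so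
twice this count is the number of ideals of norm `8 e - 1`.
-/

open Finset
open scoped Ring

section QPochhammer

variable {A : Type*} [CommRing A]

lemma eq_ringInverse_of_mul_eq_one {a b : A} (h : a * b = 1) : a = b⁻¹ʳ := by
  rw [← one_mul b⁻¹ʳ, Ring.eq_mul_inverse_iff_mul_eq _ _ _ (.of_mul_eq_one_right _ h), h]

/-- The `q`-Pochhammer symbol `(a; q)ₙ = (1 - a) (1 - a q) ⋯ (1 - a q ^ (n - 1))`. -/
def qPochhammer (a q : A) (n : ℕ) : A :=
  ∏ i ∈ range n, (1 - a * q ^ i)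

/-- The reciprocal `1 / (q; q)ₙ`. It is only meaningful if `1 - q, …, 1 - q ^ n` are units. -/
noncomputable def qPochhammerInv (q : A) (n : ℕ) : A :=
  (qPochhammer q q n)⁻¹ʳ

@[simp] lemma qPochhammer_zero (a q : A) : qPochhammer a q 0 = 1 := prod_range_zero _

@[simp] lemma qPochhammerInv_zero (q : A) : qPochhammerInv q 0 = 1 := by
  simp [qPochhammerInv]

lemma qPochhammer_succ (a q : A) (n : ℕ) :
    qPochhammer a q (n + 1) = qPochhammer a q n * (1 - a * q ^ n) :=
  prod_range_succ _ _

lemma qPochhammer_self_succ (q : A) (n : ℕ) :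
    qPochhammer q q (n + 1) = qPochhammer q q n * (1 - q ^ (n + 1)) := by
  rw [qPochhammer_succ, pow_succ']

lemma qPochhammer_self_two_mul_add_one (q : A) (n : ℕ) :
    qPochhammer q q (2 * n + 1) =
      qPochhammer (q ^ 2) (q ^ 2) n * qPochhammer q (q ^ 2) (n + 1) := by
  induction n with
  | zero => simp [qPochhammer_succ]
  | succ n ih =>
    rw [show 2 * (n + 1) + 1 = 2 * n + 1 + 1 + 1 by ring, qPochhammer_self_succ,
      qPochhammer_self_succ, ih, qPochhammer_self_succ, qPochhammer_succ _ _ (n + 1)]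
    ring

variable {q : A} (hq : ∀ n, IsUnit (1 - q ^ (n + 1)))
include hq

lemma isUnit_one_sub_sq_pow (n : ℕ) : IsUnit (1 - (q ^ 2) ^ (n + 1)) := by
  rw [← pow_mul]
  exact hq (2 * n + 1)

lemma qPochhammer_mul_qPochhammerInv (n : ℕ) : qPochhammer q q n * qPochhammerInv q n = 1 :=
  Ring.mul_inverse_cancel _ <| IsUnit.prod_iff.mpr fun i _ => by simpa only [pow_succ'] using hq i

lemma qPochhammerInv_eq_mul_succ (n : ℕ) :
    qPochhammerInv q n = (1 - q ^ (n + 1)) * qPochhammerInv q (n + 1) := by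
  have hn := qPochhammer_mul_qPochhammerInv hq n
  have hn' := qPochhammer_mul_qPochhammerInv hq (n + 1)
  rw [qPochhammer_self_succ] at hn'
  linear_combination
    (1 - q ^ (n + 1)) * qPochhammerInv q (n + 1) * hn - qPochhammerInv q n * hn'

end QPochhammer

section RogersSzego

variable {A : Type*} [CommRing A]

/-- The Rogers–Szegő polynomial in base `q ^ 2` evaluated at `q`, divided by `(q²; q²)ₙ`. -/
noncomputable def rogersSzegoSum (q : A) (n : ℕ) : A :=
  ∑ x ∈ antidiagonal n, q ^ x.1 * qPochhammerInv (q ^ 2) x.1 * qPochhammerInv (q ^ 2) x.2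

variable {q : A} (hq : ∀ n, IsUnit (1 - q ^ (n + 1)))
include hq

-- Writing `1 - q ^ (2 (i + j))` as `(1 - q ^ (2 j)) + q ^ (2 j) (1 - q ^ (2 i))` splits the sum
-- into two parts, in each of which one of the two indices is lowered.
lemma rogersSzegoSum_succ_mul (n : ℕ) :
    rogersSzegoSum q (n + 1) * (1 - q ^ (n + 1)) = rogersSzegoSum q n := by
  let P := qPochhammerInv (q ^ 2)
  have hP (i : ℕ) : (1 - (q ^ 2) ^ (i + 1)) * P (i + 1) = P i :=
    (qPochhammerInv_eq_mul_succ (isUnit_one_sub_sq_pow hq) i).symm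
  have lower_snd : ∑ x ∈ antidiagonal (n + 1), q ^ x.1 * P x.1 * ((1 - (q ^ 2) ^ x.2) * P x.2) =
      rogersSzegoSum q n := by
    rw [Nat.sum_antidiagonal_succ']
    simp only [hP, pow_zero, sub_self, zero_mul, mul_zero, zero_add]
    rfl
  have lower_fst : ∑ x ∈ antidiagonal (n + 1),
      q ^ x.1 * (q ^ 2) ^ x.2 * ((1 - (q ^ 2) ^ x.1) * P x.1) * P x.2 =
        q ^ (n + 1) * rogersSzegoSum q n := by
    rw [Nat.sum_antidiagonal_succ, rogersSzegoSum, ← Nat.sum_antidiagonal_swap, mul_sum]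
    simp only [hP, pow_zero, sub_self, zero_mul, mul_zero, zero_add]
    refine sum_congr rfl fun x hx => ?_
    rw [← mem_antidiagonal.mp hx, Prod.fst_swap, Prod.snd_swap]
    ring
  have hunit : IsUnit (1 + q ^ (n + 1)) := by
    refine isUnit_of_mul_isUnit_right (x := 1 - q ^ (n + 1)) ?_
    convert! isUnit_one_sub_sq_pow hq n using 1
    ring
  refine hunit.mul_right_cancel ?_
  rw [mul_one_add (rogersSzegoSum q n), mul_comm _ (q ^ (n + 1)), ← lower_fst, ← lower_snd,
    ← sum_add_distrib, rogersSzegoSum, mul_assoc, sum_mul]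
  refine sum_congr rfl fun x hx => ?_
  rw [← mem_antidiagonal.mp hx]
  ring

lemma rogersSzegoSum_mul_qPochhammer (n : ℕ) : rogersSzegoSum q n * qPochhammer q q n = 1 := by
  induction n with
  | zero => simp [rogersSzegoSum]
  | succ n ih =>
    rw [qPochhammer_self_succ, mul_left_comm, rogersSzegoSum_succ_mul hq, mul_comm, ih]

end RogersSzego

section Expansion

variable {M : Type*}

lemma sum_antidiagonal_eq_of_telescoping [AddCommGroup M] {f F : ℕ → ℕ → M}
    (hsucc : ∀ a m, f a (m + 1) = F a (m + 1) - F (a + 1) m) (hzero : ∀ a, f a 0 = F a 0) (n : ℕ) :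
    ∑ x ∈ antidiagonal n, f x.1 x.2 = F 0 n := by
  induction n generalizing f F with
  | zero => simp [hzero]
  | succ n ih =>
    rw [Nat.sum_antidiagonal_succ, hsucc,
      ih (f := fun a => f (a + 1)) (F := fun a => F (a + 1)) (fun a => hsucc (a + 1))
        (fun a => hzero (a + 1)), sub_add_cancel]

lemma sum_antidiagonal_two_mul_add_one [AddCommMonoid M] (f : ℕ → ℕ → M) (n : ℕ) :
    ∑ x ∈ antidiagonal (2 * n + 1), f x.1 x.2 =
      ∑ x ∈ antidiagonal n, (f x.2 (x.2 + 2 * x.1 + 1) + f (x.2 + 2 * x.1 + 1) x.2) := by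
  rw [Nat.sum_antidiagonal_eq_sum_range_succ f, Nat.sum_antidiagonal_eq_sum_range_succ
    (fun k l => f l (l + 2 * k + 1) + f (l + 2 * k + 1) l), Nat.succ_eq_add_one,
    show 2 * n + 1 + 1 = (n + 1) + (n + 1) by ring, sum_range_add, ← sum_range_reflect,
    ← sum_add_distrib]
  refine sum_congr rfl fun k hk => ?_
  obtain ⟨l, rfl⟩ := Nat.exists_eq_add_of_le (mem_range_succ_iff.mp hk)
  congr 2 <;> omega

variable {A : Type*} [CommRing A]

/-- The summand of the Bailey-type expansion of `1 / ((q; q²)ₙ (1 - q ^ (4 n + 2)))`, up to the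
factor `(q²; q²)ₙ`; the summation indices satisfy `k + a + m = n`. -/
noncomputable def baileyTerm (q : A) (k a m : ℕ) : A :=
  q ^ (a ^ 2 + 2 * k * a + a + m) * (1 - q ^ (4 * (k + 1 + a))) * qPochhammerInv (q ^ 2) m *
    qPochhammerInv (q ^ 2) (2 * (k + 1 + a) + m)

variable {q : A} (hq : ∀ n, IsUnit (1 - q ^ (n + 1)))
include hq

lemma sum_baileyTerm_mul (k l : ℕ) :
    (∑ x ∈ antidiagonal l, baileyTerm q k x.1 x.2) * (1 + q ^ (2 * (k + l) + 1)) =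
      (q ^ l + q ^ (l + 2 * k + 1)) * qPochhammerInv (q ^ 2) l *
        qPochhammerInv (q ^ 2) (l + 2 * k + 1) := by
  have hP := qPochhammerInv_eq_mul_succ (isUnit_one_sub_sq_pow hq)
  let F (a m : ℕ) : A := q ^ (a ^ 2 + 2 * k * a + a + m) * (1 + q ^ (2 * k + 1 + 2 * a)) *
    qPochhammerInv (q ^ 2) m * qPochhammerInv (q ^ 2) (m + 2 * k + 1 + 2 * a)
  have htel := sum_antidiagonal_eq_of_telescoping
    (f := fun a m => baileyTerm q k a m * (1 + q ^ (2 * (k + (a + m)) + 1))) (F := F) ?_ ?_ l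
  · calc
      _ = ∑ x ∈ antidiagonal l,
          baileyTerm q k x.1 x.2 * (1 + q ^ (2 * (k + (x.1 + x.2)) + 1)) := by
        rw [sum_mul]
        exact sum_congr rfl fun x hx => by rw [mem_antidiagonal.mp hx]
      _ = F 0 l := htel
      _ = _ := by simp only [F]; ring
  · intro a m
    simp only [F, baileyTerm]
    rw [hP m, show 2 * (k + 1 + a) + (m + 1) = m + 1 + 2 * k + 1 + 2 * a + 1 by ring,
      show m + 2 * k + 1 + 2 * (a + 1) = m + 1 + 2 * k + 1 + 2 * a + 1 by ring,
      hP (m + 1 + 2 * k + 1 + 2 * a)]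
    ring
  · intro a
    simp only [F, baileyTerm]
    rw [show 2 * (k + 1 + a) + 0 = 0 + 2 * k + 1 + 2 * a + 1 by ring, hP (0 + 2 * k + 1 + 2 * a)]
    ring

lemma sum_sum_baileyTerm_mul (n : ℕ) :
    (∑ x ∈ antidiagonal n, ∑ y ∈ antidiagonal x.2, baileyTerm q x.1 y.1 y.2) *
      (1 + q ^ (2 * n + 1)) = rogersSzegoSum q (2 * n + 1) := by
  rw [rogersSzegoSum, sum_antidiagonal_two_mul_add_one
    (fun i j => q ^ i * qPochhammerInv (q ^ 2) i * qPochhammerInv (q ^ 2) j), sum_mul]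
  refine sum_congr rfl fun x hx => ?_
  rw [← mem_antidiagonal.mp hx, sum_baileyTerm_mul hq]
  ring

lemma sum_sum_baileyTerm_eq_inverse (n : ℕ) :
    qPochhammer (q ^ 2) (q ^ 2) n *
      ∑ x ∈ antidiagonal n, ∑ y ∈ antidiagonal x.2, baileyTerm q x.1 y.1 y.2 =
        (qPochhammer q (q ^ 2) n * (1 - q ^ (4 * n + 2)))⁻¹ʳ := by
  have hS := sum_sum_baileyTerm_mul hq n
  have hprod := rogersSzegoSum_mul_qPochhammer hq (2 * n + 1)
  rw [qPochhammer_self_two_mul_add_one, qPochhammer_succ, ← pow_mul, ← pow_succ'] at hprod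
  refine eq_ringInverse_of_mul_eq_one ?_
  linear_combination qPochhammer (q ^ 2) (q ^ 2) n * qPochhammer q (q ^ 2) n *
    (1 - q ^ (2 * n + 1)) * hS + hprod

end Expansion

section Series

lemma hasSum_of_eq {ι M : Type*} [AddCommMonoid M] [TopologicalSpace M] {f g : ι → M} {a b : M}
    (h : HasSum g b) (hfg : ∀ i, f i = g i) (hab : a = b) : HasSum f a := by
  rwa [funext hfg, hab]

lemma hasSum_sub_succ {G : Type*} [AddCommGroup G] [TopologicalSpace G] [IsTopologicalAddGroup G]
    {f : ℕ → G} (hf : Summable f) : HasSum (fun m => f m - f (m + 1)) (f 0) := by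
  simpa using hf.hasSum.sub ((hasSum_nat_add_iff' 1).mpr hf.hasSum)

variable {R : Type*} [CommRing R]

/-- The terms of the limiting case `a → ∞` of the Gauss `₂φ₁` summation, with numerator parameter
`q ^ (r + 1)` and denominator parameter `q ^ (r + c + 2)`. -/
noncomputable def gaussTerm (q : R) (r c m : ℕ) : R :=
  (-1) ^ m * q ^ ((m + 1).choose 2 + c * m) * qPochhammer q q (r + m) * qPochhammerInv q m *
    qPochhammerInv q (r + 1 + c + m)

/-- The summand of the triple series that interpolates between the generating function by largest
part, with `k + a + m` constant, and an indefinite theta series, with `(k, a)` constant. -/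
noncomputable def tripleTerm (q : R) (x : (ℕ × ℕ) × ℕ) : R :=
  (-1) ^ (x.1.1 + x.1.2 + x.2 + 1) * q ^ ((x.1.1 + x.1.2 + x.2 + 1) ^ 2) *
    qPochhammer (q ^ 2) (q ^ 2) (x.1.1 + x.1.2 + x.2) * baileyTerm q x.1.1 x.1.2 x.2

/-- The exponent `2 n ^ 2 - n - k (k + 1)` of the indefinite theta series, where `n = k + 1 + a` for
`x = (k, a)`, written without subtraction. -/
def thetaExp (x : ℕ × ℕ) : ℕ :=
  (x.1 + 1 + x.2) ^ 2 + (x.2 ^ 2 + 2 * x.1 * x.2 + x.2)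

lemma sum_tripleTerm {q : R} (hq : ∀ n, IsUnit (1 - q ^ (n + 1))) (n : ℕ) :
    ∑ x ∈ antidiagonal n, ∑ y ∈ antidiagonal x.2, tripleTerm q ((x.1, y.1), y.2) =
      (-1) ^ (n + 1) * q ^ ((n + 1) ^ 2) *
        (qPochhammer q (q ^ 2) n * (1 - q ^ (4 * n + 2)))⁻¹ʳ := by
  simp only [← sum_sum_baileyTerm_eq_inverse hq, mul_sum]
  refine sum_congr rfl fun x hx => sum_congr rfl fun y hy => ?_
  simp only [tripleTerm]
  rw [add_assoc x.1, mem_antidiagonal.mp hy, mem_antidiagonal.mp hx, mul_assoc]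

lemma isUnit_one_sub_pow_succ {q : R⟦X⟧} (hq : PowerSeries.constantCoeff q = 0) (n : ℕ) :
    IsUnit (1 - q ^ (n + 1)) := by
  simp [PowerSeries.isUnit_iff_constantCoeff, hq]

variable [TopologicalSpace R] {q : R⟦X⟧} (hq : PowerSeries.constantCoeff q = 0)
include hq

lemma summable_of_pow_dvd {ι : Type*} {f : ι → R⟦X⟧} (e : ι → ℕ) (he : ∀ d, {i | e i ≤ d}.Finite)
    (hf : ∀ i, q ^ e i ∣ f i) : Summable f := by
  rw [PowerSeries.WithPiTopology.summable_iff_summable_coeff]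
  refine fun d => summable_of_hasFiniteSupport ((he d).subset fun i hi => ?_)
  by_contra hlt
  have hX : PowerSeries.X ^ e i ∣ f i :=
    (pow_dvd_pow_of_dvd (PowerSeries.X_dvd_iff.mpr hq) _).trans (hf i)
  exact hi (PowerSeries.X_pow_dvd_iff.mp hX d (by simpa using hlt))

lemma summable_tripleTerm : Summable (tripleTerm q) := by
  refine summable_of_pow_dvd hq (fun x => x.1.1 + x.1.2 + x.2) (fun d => ?_) fun x => ?_
  · refine (Set.finite_Iic ((d, d), d)).subset ?_
    intro x hx
    simp only [Set.mem_ofPred_eq, Set.mem_Iic, Prod.le_def] at hx ⊢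
    omega
  · refine dvd_mul_of_dvd_left (dvd_mul_of_dvd_left (dvd_mul_of_dvd_right (pow_dvd_pow q ?_) _) _) _
    nlinarith

variable [IsTopologicalRing R]

lemma hasSum_gauss_telescope (c : ℕ) (f : ℕ → R⟦X⟧) :
    HasSum (fun m => (-1) ^ m * q ^ ((m + 1).choose 2 + c * m) *
      (f m + q ^ (m + 1 + c) * f (m + 1))) (f 0) := by
  have := PowerSeries.WithPiTopology.instIsTopologicalRing R
  have hsummable : Summable fun m => (-1) ^ m * q ^ ((m + 1).choose 2 + c * m) * f m := by
    refine summable_of_pow_dvd hq (fun m => m) Set.finite_Iic fun m => ?_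
    refine dvd_mul_of_dvd_left (dvd_mul_of_dvd_right (pow_dvd_pow q ?_) _) _
    rw [Nat.choose_succ_succ' m 1, Nat.choose_one_right]
    omega
  refine hasSum_of_eq (hasSum_sub_succ hsummable) (fun m => ?_) (by simp)
  rw [Nat.choose_succ_succ' (m + 1) 1, Nat.choose_one_right]
  ring

lemma hasSum_gaussTerm (r c : ℕ) :
    HasSum (gaussTerm q r c) (qPochhammer q q r * qPochhammerInv q c) := by
  have := PowerSeries.WithPiTopology.instIsTopologicalRing R
  have hunit := isUnit_one_sub_pow_succ hq
  have hP := qPochhammerInv_eq_mul_succ hunit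
  induction r generalizing c with
  | zero =>
    refine hasSum_of_eq (hasSum_gauss_telescope hq c fun m => qPochhammerInv q (c + m))
      (fun m => ?_) (by simp)
    have h := qPochhammer_mul_qPochhammerInv hunit m
    rw [gaussTerm, zero_add, hP (c + m), ← add_assoc c m 1, show 0 + 1 + c + m = c + m + 1 by ring]
    linear_combination (-1) ^ m * q ^ ((m + 1).choose 2 + c * m) * qPochhammerInv q (c + m + 1) * h
  | succ r ih =>
    have htel := hasSum_gauss_telescope hq c fun m => qPochhammer q q (r + m) *
      ((1 - q ^ m) * qPochhammerInv q m) * qPochhammerInv q (r + 1 + c + m)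
    refine hasSum_of_eq (((ih (c + 1)).mul_left ((1 - q ^ (r + 1)) * (1 - q ^ (c + 1)))).add htel)
      (fun m => ?_) ?_
    · simp only [gaussTerm]
      rw [show r + 1 + 1 + c + m = r + 1 + c + m + 1 by ring,
        show r + 1 + (c + 1) + m = r + 1 + c + m + 1 by ring, show r + 1 + m = r + m + 1 by ring,
        ← add_assoc r m 1, hP (r + 1 + c + m), qPochhammer_self_succ, ← add_assoc (r + 1 + c) m 1,
        hP m]
      ring
    · rw [qPochhammer_self_succ, hP c, pow_zero, sub_self]
      ring

lemma hasSum_tripleTerm_fiber (x : ℕ × ℕ) : HasSum (fun m => tripleTerm q (x, m))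
    ((-1) ^ (x.1 + 1 + x.2) * (q ^ thetaExp x + q ^ (thetaExp x + 2 * (x.1 + 1 + x.2)))) := by
  have := PowerSeries.WithPiTopology.instIsTopologicalRing R
  obtain ⟨k, a⟩ := x
  have hq2 : PowerSeries.constantCoeff (q ^ 2) = 0 := by simp [hq]
  refine hasSum_of_eq ((hasSum_gaussTerm hq2 (k + a) (k + a + 1)).mul_left
    ((-1) ^ (k + 1 + a) * q ^ thetaExp (k, a) * (1 - q ^ (4 * (k + 1 + a))))) (fun m => ?_) ?_
  · have hchoose : 2 * (m + 1).choose 2 = m * (m + 1) := by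
      simpa [mul_comm] using (Nat.add_one_mul_choose_eq m 1).symm
    simp only [tripleTerm, baileyTerm, gaussTerm, thetaExp]
    rw [show k + a + 1 + (k + a + 1) + m = 2 * (k + 1 + a) + m by ring, ← pow_mul,
      mul_add 2 ((m + 1).choose 2), hchoose]
    ring
  · have h := qPochhammer_mul_qPochhammerInv (isUnit_one_sub_pow_succ hq2) (k + a)
    rw [qPochhammerInv_eq_mul_succ (isUnit_one_sub_pow_succ hq2)] at h
    linear_combination (-(-1) ^ (k + 1 + a) * q ^ thetaExp (k, a) *
      (1 + q ^ (2 * (k + 1 + a)))) * h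

end Series

section Fibers

lemma hasSum_sum_fiber {ι κ M : Type*} [AddCommMonoid M] [TopologicalSpace M] [ContinuousAdd M]
    [RegularSpace M] {f : ι → M} {s : M} (hf : HasSum f s) (g : ι → κ) {F : κ → Finset ι}
    (hF : ∀ i j, i ∈ F j ↔ g i = j) : HasSum (fun j => ∑ i ∈ F j, f i) s := by
  refine ((Equiv.sigmaFiberEquiv g).hasSum_iff.mpr hf).sigma fun j => ?_
  rw [← (F j).sum_coe_sort f]
  exact (Equiv.subtypeEquivRight (hF · j)).hasSum_iff.mp (hasSum_fintype _)

lemma hasSum_C_mul_X_pow {ι R : Type*} [Semiring R] [TopologicalSpace R] (e : ι → ℕ)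
    (he : ∀ m, {i | e i = m}.Finite) (g : ℕ → R) :
    HasSum (fun i => PowerSeries.C (g (e i)) * (PowerSeries.X : R⟦X⟧) ^ e i)
      (PowerSeries.mk fun m => {i | e i = m}.ncard • g m) := by
  refine (PowerSeries.WithPiTopology.hasSum_iff_hasSum_coeff R).mpr fun m => ?_
  have hsupp : ∀ i ∉ (he m).toFinset,
      PowerSeries.coeff m (PowerSeries.C (g (e i)) * (PowerSeries.X : R⟦X⟧) ^ e i) = 0 := by
    intro i hi
    rw [PowerSeries.coeff_C_mul_X_pow, if_neg fun h => hi ((he m).mem_toFinset.mpr h.symm)]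
  refine hasSum_of_eq (hasSum_sum_of_ne_finset_zero hsupp) (fun _ => rfl) ?_
  rw [PowerSeries.coeff_mk, Set.ncard_eq_toFinset_card _ (he m), ← sum_const]
  refine sum_congr rfl fun i hi => ?_
  have hei : e i = m := (he m).mem_toFinset.mp hi
  rw [PowerSeries.coeff_C_mul_X_pow, if_pos hei.symm, hei]

variable {R : Type*} [CommRing R] [TopologicalSpace R] [IsTopologicalRing R] {q : R⟦X⟧}

lemma hasSum_tripleTerm_antidiagonal (hq : PowerSeries.constantCoeff q = 0) :
    HasSum (fun n => (-1) ^ (n + 1) * q ^ ((n + 1) ^ 2) *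
      (qPochhammer q (q ^ 2) n * (1 - q ^ (4 * n + 2)))⁻¹ʳ) (∑' x, tripleTerm q x) := by
  have := PowerSeries.WithPiTopology.instIsTopologicalRing R
  refine hasSum_of_eq (hasSum_sum_fiber (summable_tripleTerm hq).hasSum
    (fun x => x.1.1 + x.1.2 + x.2) (F := fun n =>
      ((antidiagonal n).sigma fun x => antidiagonal x.2).image fun y => ((y.1.1, y.2.1), y.2.2))
    fun x n => ?_) (fun n => ?_) rfl
  · simp only [mem_image, mem_sigma, HasAntidiagonal.mem_antidiagonal]
    refine ⟨by grind, fun h => ⟨⟨(x.1.1, x.1.2 + x.2), (x.1.2, x.2)⟩, ⟨?_, rfl⟩, rfl⟩⟩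
    rw [← h, add_assoc]
  · rw [sum_image, sum_sigma, sum_tripleTerm (isUnit_one_sub_pow_succ hq)]
    intro x hx y hy hxy
    simp only [coe_sigma, Set.mem_sigma_iff, mem_coe, HasAntidiagonal.mem_antidiagonal] at hx hy
    grind

lemma hasSum_theta (hq : PowerSeries.constantCoeff q = 0) :
    HasSum (fun x : ℕ × ℕ => (-1) ^ (x.1 + 1 + x.2) *
      (q ^ thetaExp x + q ^ (thetaExp x + 2 * (x.1 + 1 + x.2)))) (∑' x, tripleTerm q x) := by
  have := PowerSeries.WithPiTopology.instIsTopologicalRing R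
  exact (summable_tripleTerm hq).hasSum.prod_fiberwise (hasSum_tripleTerm_fiber hq)

end Fibers

section GeneratingFunction

lemma exists_partition_toFinsuppAntidiag_eq {S : Finset ℕ} (hS : 0 ∉ S) {d : ℕ} {g : ℕ →₀ ℕ}
    (hg : g ∈ S.finsuppAntidiag d) (hdvd : ∀ i ∈ S, i ∣ g i) :
    ∃ p : d.Partition, p.toFinsuppAntidiag = g := by
  obtain ⟨hsum, hsupp⟩ := mem_finsuppAntidiag.mp hg
  have hpos (i : ℕ) (hi : g i ≠ 0) : 0 < i :=
    Nat.pos_of_ne_zero fun h => hS (h ▸ hsupp (Finsupp.mem_support_iff.mpr hi))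
  let f : ℕ →₀ ℕ := Finsupp.onFinset g.support (fun i => g i / i) fun i hi =>
    Finsupp.mem_support_iff.mpr fun h => hi (by simp [h])
  have hmul (i : ℕ) : f i * i = g i := by
    by_cases hi : g i = 0
    · simp [f, hi]
    · exact Nat.div_mul_cancel (hdvd i (hsupp (Finsupp.mem_support_iff.mpr hi)))
  refine ⟨⟨f.toMultiset, fun {i} hi => ?_, ?_⟩, ?_⟩
  · refine hpos i fun h => ?_
    simp only [f, Finsupp.mem_toMultiset, Finsupp.mem_support_iff, Finsupp.onFinset_apply, h,
      Nat.zero_div, ne_eq, not_true_eq_false] at hi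
  · rw [sum_multiset_count, Finsupp.toFinset_toMultiset, ← hsum]
    simp only [Finsupp.count_toMultiset, smul_eq_mul]
    refine (sum_congr rfl fun i _ => hmul i).trans (sum_subset ?_ fun i _ hi => ?_)
    · exact (Finsupp.support_onFinset_subset).trans hsupp
    · rw [← hmul i, Finsupp.notMem_support_iff.mp hi, zero_mul]
  · ext i
    change f.toMultiset.count i * i = g i
    rw [Finsupp.count_toMultiset]
    exact hmul i

lemma coeff_prod_eq_sum_partition {R : Type*} [CommSemiring R] {S : Finset ℕ} (hS : 0 ∉ S)
    (φ : ℕ → R⟦X⟧) (hφ : ∀ i ∈ S, ∀ e, ¬ i ∣ e → PowerSeries.coeff e (φ i) = 0) (d : ℕ) :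
    PowerSeries.coeff d (∏ i ∈ S, φ i) = ∑ p : d.Partition with p.parts.toFinset ⊆ S,
      ∏ i ∈ S, PowerSeries.coeff (p.parts.count i * i) (φ i) := by
  rw [PowerSeries.coeff_prod]
  refine (sum_of_injOn Nat.Partition.toFinsuppAntidiag
    (Nat.Partition.toFinsuppAntidiag_injective d).injOn (fun p hp => ?_) (fun g hg hrange => ?_)
    fun p _ => rfl).symm
  · have hp : p.parts.toFinset ⊆ S := by simpa using hp
    refine mem_finsuppAntidiag.mpr ⟨?_, hp⟩
    refine Eq.trans ?_ p.parts_sum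
    rw [sum_multiset_count]
    refine (sum_subset (f := fun i => p.parts.count i • i) hp fun i _ hi => ?_).symm
    rw [Multiset.count_eq_zero_of_notMem fun h => hi (Multiset.mem_toFinset.mpr h), zero_smul]
  · by_contra hne
    have hdvd : ∀ i ∈ S, i ∣ g i := fun i hi =>
      by_contra fun h => hne (prod_eq_zero hi (hφ i hi _ h))
    obtain ⟨p, rfl⟩ := exists_partition_toFinsuppAntidiag_eq hS hg hdvd
    exact hrange ⟨p, mem_filter.mpr ⟨mem_univ p, (mem_finsuppAntidiag.mp hg).2⟩, rfl⟩

lemma inverse_one_sub_X_pow {R : Type*} [CommRing R] {n : ℕ} (hn : n ≠ 0) :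
    (1 - PowerSeries.X ^ n : R⟦X⟧)⁻¹ʳ = PowerSeries.mk fun e => if n ∣ e then 1 else 0 := by
  have hexpand : (PowerSeries.mk fun e => if n ∣ e then 1 else 0 : R⟦X⟧) =
      PowerSeries.expand n hn (PowerSeries.mk 1) := by
    ext e
    by_cases h : n ∣ e
    · obtain ⟨m, rfl⟩ := h
      simp [PowerSeries.coeff_expand_mul]
    · simp [PowerSeries.coeff_expand_of_not_dvd, h]
  refine (eq_ringInverse_of_mul_eq_one ?_).symm
  rw [hexpand, ← PowerSeries.expand_X n hn, ← map_one (PowerSeries.expand n hn), ← map_sub,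
    ← map_mul, PowerSeries.mk_one_mul_one_sub_eq_one]

lemma coeff_X_pow_mul_inverse_one_sub {R : Type*} [CommRing R] {i t : ℕ} (hi : i ≠ 0) (ht : t ≠ 0)
    (d : ℕ) : PowerSeries.coeff d (PowerSeries.X ^ i * (1 - PowerSeries.X ^ (t * i) : R⟦X⟧)⁻¹ʳ) =
      if i ≤ d ∧ t * i ∣ d - i then 1 else 0 := by
  rw [inverse_one_sub_X_pow (mul_ne_zero ht hi), PowerSeries.coeff_X_pow_mul', ite_and,
    PowerSeries.coeff_mk]

lemma coeff_prod_X_pow_mul_inverse {R : Type*} [CommRing R] {S : Finset ℕ} (hS : 0 ∉ S) {t : ℕ → ℕ}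
    (ht : ∀ i, t i ≠ 0) (d : ℕ) :
    PowerSeries.coeff d
        (∏ i ∈ S, ((PowerSeries.X : R⟦X⟧) ^ i * (1 - (PowerSeries.X : R⟦X⟧) ^ (t i * i))⁻¹ʳ)) =
      #{p : d.Partition | p.parts.toFinset ⊆ S ∧
        ∀ i ∈ S, 1 ≤ p.parts.count i ∧ t i ∣ p.parts.count i - 1} := by
  have hne (i : ℕ) (hi : i ∈ S) : i ≠ 0 := fun h => hS (h ▸ hi)
  rw [coeff_prod_eq_sum_partition hS]
  · rw [← filter_filter, ← sum_boole]
    refine sum_congr rfl fun p _ => ?_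
    rw [prod_congr rfl fun i (hi : i ∈ S) =>
      coeff_X_pow_mul_inverse_one_sub (R := R) (hne i hi) (ht i) (p.parts.count i * i), prod_boole]
    refine if_congr (forall₂_congr fun i hi => ?_) rfl rfl
    have hi0 := Nat.pos_of_ne_zero (hne i hi)
    rw [← Nat.sub_one_mul, Nat.mul_dvd_mul_iff_right hi0, le_mul_iff_one_le_left hi0]
  · intro i hi e hie
    rw [coeff_X_pow_mul_inverse_one_sub (hne i hi) (ht i), if_neg]
    rintro ⟨hle, hdvd⟩
    exact hie ((Nat.dvd_sub_iff_left hle dvd_rfl).mp (dvd_of_mul_left_dvd hdvd))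

/-- The odd numbers `1, 3, …, 2 * n + 1`. -/
def oddsUpTo (n : ℕ) : Finset ℕ :=
  (range (n + 1)).image fun i => 2 * i + 1

lemma mem_oddsUpTo {n i : ℕ} : i ∈ oddsUpTo n ↔ Odd i ∧ i ≤ 2 * n + 1 := by
  simp only [oddsUpTo, mem_image, mem_range]
  refine ⟨by grind, ?_⟩
  rintro ⟨⟨j, rfl⟩, hle⟩
  exact ⟨j, by omega, rfl⟩

lemma prod_oddsUpTo {M : Type*} [CommMonoid M] (f : ℕ → M) (n : ℕ) :
    ∏ i ∈ oddsUpTo n, f i = (∏ i ∈ range n, f (2 * i + 1)) * f (2 * n + 1) := by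
  rw [oddsUpTo, prod_image fun i _ j _ h => by simpa using h, prod_range_succ]

lemma IsOStarPartition.sup_mem {d : ℕ} {p : d.Partition} (hp : IsOStarPartition p) :
    p.parts.sup ∈ p.parts :=
  Multiset.one_le_count_iff_mem.mp hp.2.2.pos

lemma isOStarPartition_and_sup_eq_iff {d n : ℕ} (p : d.Partition) :
    IsOStarPartition p ∧ p.parts.sup = 2 * n + 1 ↔
      p.parts.toFinset ⊆ oddsUpTo n ∧ ∀ i ∈ oddsUpTo n,
        1 ≤ p.parts.count i ∧ (if i = 2 * n + 1 then 2 else 1) ∣ p.parts.count i - 1 := by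
  have htop : 2 * n + 1 ∈ oddsUpTo n := mem_oddsUpTo.mpr ⟨⟨n, rfl⟩, le_rfl⟩
  constructor
  · rintro ⟨hp, hsup⟩
    have hmem := hp.sup_mem
    obtain ⟨hodd, hlower, hcount⟩ := hp
    rw [hsup] at hmem hcount
    refine ⟨fun i hi => ?_, fun i hi => ⟨?_, ?_⟩⟩
    · rw [Multiset.mem_toFinset] at hi
      exact mem_oddsUpTo.mpr ⟨hodd i hi, hsup ▸ Multiset.le_sup hi⟩
    · obtain ⟨hi, hle⟩ := mem_oddsUpTo.mp hi
      rw [Multiset.one_le_count_iff_mem]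
      exact hle.eq_or_lt.elim (fun h => h ▸ hmem) fun hlt => hlower _ hmem i hlt hi
    · split_ifs with h
      · exact h ▸ (Nat.Odd.sub_odd hcount odd_one).two_dvd
      · exact one_dvd _
  · rintro ⟨hsub, hcount⟩
    have hmem (i : ℕ) : i ∈ p.parts ↔ Odd i ∧ i ≤ 2 * n + 1 := by
      rw [← mem_oddsUpTo]
      exact ⟨fun hi => hsub (Multiset.mem_toFinset.mpr hi),
        fun hi => Multiset.one_le_count_iff_mem.mp (hcount i hi).1⟩
    have hsup : p.parts.sup = 2 * n + 1 :=
      le_antisymm (Multiset.sup_le.mpr fun i hi => ((hmem i).mp hi).2)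
        (Multiset.le_sup ((hmem _).mpr (mem_oddsUpTo.mp htop)))
    refine ⟨⟨fun i hi => ((hmem i).mp hi).1,
      fun i hi j hj hjo => (hmem j).mpr ⟨hjo, hj.le.trans ((hmem i).mp hi).2⟩, ?_⟩, hsup⟩
    obtain ⟨hpos, hdvd⟩ := hcount (2 * n + 1) htop
    rw [if_pos rfl] at hdvd
    rw [hsup]
    grind

lemma prod_oddsUpTo_X_pow_mul_inverse (R : Type*) [CommRing R] (n : ℕ) :
    ∏ i ∈ oddsUpTo n, ((PowerSeries.X : R⟦X⟧) ^ i *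
      (1 - (PowerSeries.X : R⟦X⟧) ^ ((if i = 2 * n + 1 then 2 else 1) * i))⁻¹ʳ) =
        PowerSeries.X ^ ((n + 1) ^ 2) * (qPochhammer PowerSeries.X (PowerSeries.X ^ 2) n *
          (1 - PowerSeries.X ^ (4 * n + 2)))⁻¹ʳ := by
  have hsum : ∑ i ∈ oddsUpTo n, i = (n + 1) ^ 2 := by
    rw [oddsUpTo, sum_image fun i _ j _ h => by simpa using h]
    induction n with
    | zero => rfl
    | succ n ih => rw [sum_range_succ, ih]; ring
  rw [prod_mul_distrib, prod_pow_eq_pow_sum, hsum]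
  simp only [← MonoidWithZero.inverse_apply]
  rw [← map_prod, prod_oddsUpTo, if_pos rfl, qPochhammer]
  congr 3
  · refine prod_congr rfl fun i hi => ?_
    rw [if_neg (by grind), one_mul, ← pow_mul, pow_succ']
  · ring

open Classical in
lemma coeff_largestPart_term (d n : ℕ) :
    PowerSeries.coeff d ((-1) ^ (n + 1) * PowerSeries.X ^ ((n + 1) ^ 2) *
      (qPochhammer PowerSeries.X (PowerSeries.X ^ 2) n *
        (1 - PowerSeries.X ^ (4 * n + 2)) : ℤ⟦X⟧)⁻¹ʳ) =
      ∑ p : d.Partition with (p.parts.sup - 1) / 2 = n,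
        if IsOStarPartition p then oWeight p else 0 := by
  have hfilter (p : d.Partition) : (p.parts.sup - 1) / 2 = n ∧ IsOStarPartition p ↔
      IsOStarPartition p ∧ p.parts.sup = 2 * n + 1 := by
    rw [and_comm]
    refine and_congr_right fun hp => ?_
    have := hp.1 _ hp.sup_mem
    grind
  have hsign : ((-1) ^ (n + 1) : ℤ⟦X⟧) = PowerSeries.C ((-1) ^ (n + 1)) := by simp
  rw [mul_assoc, ← prod_oddsUpTo_X_pow_mul_inverse, hsign, PowerSeries.coeff_C_mul,
    coeff_prod_X_pow_mul_inverse (by simp [mem_oddsUpTo]) (by grind), ← sum_filter, filter_filter]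
  simp only [← isOStarPartition_and_sup_eq_iff, hfilter]
  rw [← nsmul_eq_mul', ← sum_const]
  refine sum_congr rfl fun p hp => ?_
  rw [oWeight, (mem_filter.mp hp).2.2]
  split_ifs with h
  · exact Odd.neg_one_pow (by grind)
  · exact Even.neg_one_pow (by grind)

lemma hasSum_mk_OStar : HasSum (fun n => (-1) ^ (n + 1) * PowerSeries.X ^ ((n + 1) ^ 2) *
      (qPochhammer PowerSeries.X (PowerSeries.X ^ 2) n *
        (1 - PowerSeries.X ^ (4 * n + 2)) : ℤ⟦X⟧)⁻¹ʳ) (PowerSeries.mk OStar) := by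
  classical
  refine (PowerSeries.WithPiTopology.hasSum_iff_hasSum_coeff ℤ).mpr fun d => ?_
  refine hasSum_of_eq (hasSum_sum_fiber (hasSum_fintype fun p : d.Partition =>
    if IsOStarPartition p then oWeight p else 0) (fun p => (p.parts.sup - 1) / 2)
    fun p n => mem_filter_univ p) (coeff_largestPart_term d) ?_
  rw [PowerSeries.coeff_mk, OStar, sum_filter]

end GeneratingFunction

section Theta

lemma neg_one_pow_thetaExp (x : ℕ × ℕ) : (-1 : ℤ) ^ thetaExp x = (-1) ^ (x.1 + 1 + x.2) := by
  refine neg_one_pow_congr ?_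
  simp only [thetaExp]
  grind

lemma finite_thetaExp_eq (d : ℕ) : {x | thetaExp x = d}.Finite := by
  refine (Set.finite_Iic (d, d)).subset ?_
  rintro x rfl
  simp only [thetaExp, Set.mem_Iic, Prod.le_def]
  constructor <;> nlinarith

lemma finite_thetaExp_add_eq (d : ℕ) : {x | thetaExp x + 2 * (x.1 + 1 + x.2) = d}.Finite := by
  refine (Set.finite_Iic d).biUnion (fun e _ => finite_thetaExp_eq e) |>.subset ?_
  intro x hx
  simp only [Set.mem_iUnion]
  exact ⟨thetaExp x, (Nat.le_add_right _ _).trans_eq hx, rfl⟩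

lemma OStar_eq_ncard (d : ℕ) : OStar d = (-1) ^ d *
    ({x | thetaExp x = d}.ncard + {x | thetaExp x + 2 * (x.1 + 1 + x.2) = d}.ncard) := by
  have := PowerSeries.WithPiTopology.instIsTopologicalRing ℤ
  have hX : PowerSeries.constantCoeff (PowerSeries.X : ℤ⟦X⟧) = 0 :=
    PowerSeries.constantCoeff_X
  have hC (m : ℕ) : PowerSeries.C ((-1 : ℤ) ^ m) = (-1) ^ m := by simp
  have htheta := (hasSum_C_mul_X_pow thetaExp finite_thetaExp_eq ((-1 : ℤ) ^ ·)).add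
    (hasSum_C_mul_X_pow _ finite_thetaExp_add_eq ((-1 : ℤ) ^ ·))
  have hOStar := (hasSum_tripleTerm_antidiagonal hX).unique hasSum_mk_OStar
  have key := (hOStar ▸ hasSum_theta hX).unique (hasSum_of_eq htheta (fun x => by
    rw [pow_add (-1 : ℤ) (thetaExp x), pow_mul (-1 : ℤ) 2, neg_one_sq, one_pow, mul_one,
      neg_one_pow_thetaExp, hC, mul_add]) rfl)
  simpa [mul_comm, mul_add] using congrArg (PowerSeries.coeff d) key

end Theta

section QuadraticOrder

lemma even_and_even_of_sq_eq_add_four_mul {d A B s : ℤ} (hd : Squarefree d) (hd4 : d % 4 ≠ 1)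
    (h : A ^ 2 = d * s ^ 2 + 4 * B) : Even A ∧ Even s := by
  have hd0 : d % 4 ≠ 0 := fun h0 => by
    simpa using Int.isUnit_iff.mp (hd 2 (by omega))
  have hs : Even s := by
    by_contra hs
    obtain ⟨t, rfl⟩ := Int.not_even_iff_odd.mp hs
    have hA : A ^ 2 = d + 4 * (d * (t ^ 2 + t) + B) := by linear_combination h
    rcases Int.even_or_odd' A with ⟨r, rfl | rfl⟩ <;> ring_nf at hA <;> omega
  refine ⟨?_, hs⟩
  obtain ⟨t, rfl⟩ := hs
  have : Even (A ^ 2) := ⟨2 * (d * t ^ 2 + B), by linear_combination h⟩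
  exact (Int.even_pow.mp this).1

lemma exists_int_of_trace_of_norm {d A B : ℤ} (hd : Squarefree d) (hd4 : d % 4 ≠ 1) {p q : ℚ}
    (hA : (A : ℚ) = 2 * p) (hB : (B : ℚ) = p ^ 2 - d * q ^ 2) :
    ∃ x y : ℤ, (x : ℚ) = p ∧ (y : ℚ) = q := by
  obtain ⟨C, hC⟩ : ∃ C : ℤ, (C : ℚ) = 2 * d * q := by
    have hsq : (2 * d * q) ^ 2 = ((d * (A ^ 2 - 4 * B) : ℤ) : ℚ) := by
      push_cast
      rw [hA, hB]
      ring
    have : IsIntegral ℤ (2 * d * q) :=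
      .of_pow two_pos (hsq ▸ isIntegral_algebraMap (R := ℤ) (A := ℚ))
    exact IsIntegrallyClosed.isIntegral_iff.mp this
  have hCsq : C ^ 2 = d * (A ^ 2 - 4 * B) := by
    have : (C : ℚ) ^ 2 = d * (A ^ 2 - 4 * B) := by
      rw [hA, hB, hC]
      ring
    exact_mod_cast this
  obtain ⟨s, rfl⟩ : d ∣ C := hd.isRadical 2 C ⟨_, hCsq⟩
  have hsq : A ^ 2 = d * s ^ 2 + 4 * B :=
    mul_left_cancel₀ hd.ne_zero (by linear_combination -hCsq)
  obtain ⟨⟨x, rfl⟩, ⟨y, rfl⟩⟩ := even_and_even_of_sq_eq_add_four_mul hd hd4 hsq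
  have hd0 : (d : ℚ) ≠ 0 := Int.cast_ne_zero.mpr hd.ne_zero
  push_cast at hA hC
  exact ⟨x, y, by linarith, mul_left_cancel₀ hd0 (by linarith)⟩

lemma exists_int_of_isIntegral {d : ℤ} (hd : Squarefree d) (hd4 : d % 4 ≠ 1)
    {w : QuadraticAlgebra ℚ d 0} (hw : IsIntegral ℤ w) : ∃ x y : ℤ, w = ⟨x, y⟩ := by
  have hw' : IsIntegral ℤ (star w) := hw.map (starRingEnd (QuadraticAlgebra ℚ d 0)).toIntAlgHom
  have hC : Function.Injective (algebraMap ℚ (QuadraticAlgebra ℚ d 0)) :=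
    QuadraticAlgebra.C_injective
  have htrace : IsIntegral ℤ w.trace := by
    rw [← isIntegral_algebraMap_iff hC, QuadraticAlgebra.algebraMap_trace_eq_add_star]
    exact hw.add hw'
  have hnorm : IsIntegral ℤ w.norm := by
    rw [← isIntegral_algebraMap_iff hC, QuadraticAlgebra.algebraMap_norm_eq_mul_star]
    exact hw.mul hw'
  obtain ⟨A, hA⟩ := IsIntegrallyClosed.isIntegral_iff.mp htrace
  obtain ⟨B, hB⟩ := IsIntegrallyClosed.isIntegral_iff.mp hnorm
  obtain ⟨x, y, hx, hy⟩ := exists_int_of_trace_of_norm hd hd4 (p := w.re) (q := w.im)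
    (by simpa [QuadraticAlgebra.trace_def] using hA)
    (by simpa [QuadraticAlgebra.norm_def, sq, mul_assoc] using hB)
  exact ⟨x, y, QuadraticAlgebra.ext hx.symm hy.symm⟩

end QuadraticOrder

section QuadraticField

variable {F E : Type*} [Field F] [Field E] [Algebra F E] {a b : F}

lemma fieldRange_quadraticAlgebra_lift [Fact (∀ r : F, r ^ 2 ≠ a + b * r)]
    (u : {u : E // u * u = a • 1 + b • u}) :
    (QuadraticAlgebra.lift u).fieldRange = F⟮(u : E)⟯ := by
  refine le_antisymm ?_ ?_
  · rintro _ ⟨z, rfl⟩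
    exact add_mem (F⟮(u : E)⟯.smul_mem (one_mem _))
      (F⟮(u : E)⟯.smul_mem (IntermediateField.mem_adjoin_simple_self F _))
  · exact IntermediateField.adjoin_simple_le_iff.mpr ⟨QuadraticAlgebra.omega, by simp⟩

/-- The identification of the quadratic extension `F[X] / (X ^ 2 - b X - a)` of `F` with the
subfield `F(u)` of `E`, where `u` is a root of `X ^ 2 - b X - a` in `E`. -/
noncomputable def quadraticAlgebraEquivAdjoin [Fact (∀ r : F, r ^ 2 ≠ a + b * r)]
    (u : {u : E // u * u = a • 1 + b • u}) : QuadraticAlgebra F a b ≃ₐ[F] F⟮(u : E)⟯ :=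
  (AlgEquiv.ofInjectiveField (QuadraticAlgebra.lift u)).trans <|
    IntermediateField.equivOfEq (fieldRange_quadraticAlgebra_lift u)

end QuadraticField

section RingOfIntegers

variable {K : Type*} [Field K] [CharZero K] {d : ℤ} (e : QuadraticAlgebra ℚ d 0 ≃ₐ[ℚ] K)

/-- The square root of `d` in the ring of integers of `ℚ(√d)`. -/
noncomputable def sqrtInt : 𝓞 K :=
  ⟨e QuadraticAlgebra.omega, .of_pow two_pos <| by
    rw [sq, ← map_mul, QuadraticAlgebra.omega_mul_omega_eq_add]
    simpa using isIntegral_algebraMap (R := ℤ) (A := K) (x := d)⟩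

lemma coe_sqrtInt : (sqrtInt e : K) = e QuadraticAlgebra.omega :=
  rfl

lemma sqrtInt_mul_self : sqrtInt e * sqrtInt e = d := by
  have h : e QuadraticAlgebra.omega * e QuadraticAlgebra.omega = d := by
    rw [← map_mul, QuadraticAlgebra.omega_mul_omega_eq_add]
    simp
  ext
  exact h

/-- The inclusion of `ℤ[√d]` into the ring of integers of `ℚ(√d)`. -/
noncomputable def quadraticToRingOfIntegers : QuadraticAlgebra ℤ d 0 →ₐ[ℤ] 𝓞 K :=
  QuadraticAlgebra.lift ⟨sqrtInt e, by simp [sqrtInt_mul_self]⟩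

lemma coe_quadraticToRingOfIntegers (z : QuadraticAlgebra ℤ d 0) :
    (quadraticToRingOfIntegers e z : K) = e ⟨z.re, z.im⟩ := by
  have h : quadraticToRingOfIntegers e z = z.re + z.im * sqrtInt e := by
    simp [quadraticToRingOfIntegers]
  rw [h, QuadraticAlgebra.mk_eq_add_smul_omega]
  simp [coe_sqrtInt, Algebra.smul_def]

/-- The ring of integers of `ℚ(√d)` is `ℤ[√d]` for squarefree `d ≢ 1 mod 4`. -/
noncomputable def quadraticEquivRingOfIntegers (hd : Squarefree d) (hd4 : d % 4 ≠ 1) :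
    QuadraticAlgebra ℤ d 0 ≃ₐ[ℤ] 𝓞 K :=
  .ofBijective (quadraticToRingOfIntegers e) <| by
    refine ⟨fun z w h => ?_, fun a => ?_⟩
    · have h' := congrArg ((↑) : 𝓞 K → K) h
      rw [coe_quadraticToRingOfIntegers, coe_quadraticToRingOfIntegers, e.injective.eq_iff] at h'
      simpa [QuadraticAlgebra.ext_iff] using h'
    · obtain ⟨x, y, hxy⟩ := exists_int_of_isIntegral hd hd4
        (a.isIntegral_coe.map (e.symm.toAlgHom.restrictScalars ℤ))
      refine ⟨⟨x, y⟩, ?_⟩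
      ext
      rw [coe_quadraticToRingOfIntegers, ← hxy]
      simp

end RingOfIntegers

section AbsNorm

variable {R : Type*} [CommRing R] {a b : R}

lemma algebra_norm_eq_quadraticAlgebra_norm (z : QuadraticAlgebra R a b) :
    Algebra.norm R z = z.norm :=
  QuadraticAlgebra.det_toLinearMap_eq_norm z

lemma quadraticAlgebra_basis_zero : QuadraticAlgebra.basis a b 0 = 1 := by
  rw [Module.Basis.apply_eq_iff]
  ext i
  fin_cases i <;> simp [QuadraticAlgebra.re_one, QuadraticAlgebra.im_one]

lemma quadraticAlgebra_basis_one : QuadraticAlgebra.basis a b 1 = QuadraticAlgebra.omega := by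
  rw [Module.Basis.apply_eq_iff]
  ext i
  fin_cases i <;> simp

lemma algebra_trace_eq_quadraticAlgebra_trace (z : QuadraticAlgebra R a b) :
    Algebra.trace R _ z = z.trace := by
  rw [Algebra.trace_eq_matrix_trace (QuadraticAlgebra.basis a b), Matrix.trace_fin_two]
  simp only [Algebra.leftMulMatrix_eq_repr_mul, quadraticAlgebra_basis_zero,
    quadraticAlgebra_basis_one, QuadraticAlgebra.basis_repr_apply, QuadraticAlgebra.re_mul,
    QuadraticAlgebra.im_mul, QuadraticAlgebra.re_one, QuadraticAlgebra.im_one,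
    QuadraticAlgebra.omega_re, QuadraticAlgebra.omega_im, QuadraticAlgebra.trace_def,
    Matrix.cons_val_zero, Matrix.cons_val_one, Matrix.cons_val_fin_one]
  ring

lemma discr_quadraticAlgebra_basis :
    Algebra.discr R (QuadraticAlgebra.basis a b) = b ^ 2 + 4 * a := by
  rw [Algebra.discr_def, Matrix.det_fin_two]
  simp only [Algebra.traceMatrix_apply, Algebra.traceForm_apply,
    algebra_trace_eq_quadraticAlgebra_trace, quadraticAlgebra_basis_zero,
    quadraticAlgebra_basis_one, QuadraticAlgebra.trace_def, QuadraticAlgebra.re_mul,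
    QuadraticAlgebra.im_mul, QuadraticAlgebra.re_one, QuadraticAlgebra.im_one,
    QuadraticAlgebra.omega_re, QuadraticAlgebra.omega_im]
  ring

lemma absNorm_span_singleton_quadraticAlgebra_equiv {S : Type*} [CommRing S] [IsDedekindDomain S]
    [Module.Free ℤ S] [Module.Finite ℤ S] {a b : ℤ} (e : QuadraticAlgebra ℤ a b ≃ₐ[ℤ] S)
    (z : QuadraticAlgebra ℤ a b) :
    Ideal.absNorm (Ideal.span {e z}) = z.norm.natAbs := by
  rw [Ideal.absNorm_span_singleton, ← algebra_norm_eq_quadraticAlgebra_norm,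
    Algebra.norm_eq_of_algEquiv]

variable {K : Type*} [Field K] [NumberField K] {d : ℤ}

lemma discr_eq_four_mul (e : QuadraticAlgebra ℤ d 0 ≃ₐ[ℤ] 𝓞 K) : NumberField.discr K = 4 * d := by
  rw [← NumberField.discr_eq_discr K ((QuadraticAlgebra.basis d 0).map e.toLinearEquiv)]
  have h := Algebra.discr_eq_discr_of_algEquiv (QuadraticAlgebra.basis d 0) e
  rw [discr_quadraticAlgebra_basis, zero_pow two_ne_zero, zero_add] at h
  exact (congrArg _ (funext fun i => Module.Basis.map_apply ..)).trans h.symm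

lemma isPrincipalIdealRing_of_abs_le_two (e : QuadraticAlgebra ℤ d 0 ≃ₐ[ℤ] 𝓞 K) (hd : |d| ≤ 2) :
    IsPrincipalIdealRing (𝓞 K) := by
  have hrank : Module.finrank ℚ K = 2 := by
    rw [← NumberField.RingOfIntegers.rank, ← e.toLinearEquiv.finrank_eq,
      QuadraticAlgebra.finrank_eq_two]
  have hr : NumberField.InfinitePlace.nrComplexPlaces K ≤ 1 := by
    have := NumberField.InfinitePlace.card_add_two_mul_card_eq_rank K
    omega
  apply RingOfIntegers.isPrincipalIdealRing_of_abs_discr_lt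
  rw [hrank, discr_eq_four_mul e]
  have hπ : Real.pi / 4 ≤ (Real.pi / 4) ^ NumberField.InfinitePlace.nrComplexPlaces K := by
    simpa using pow_le_pow_of_le_one (by positivity) (by linarith [Real.pi_le_four]) hr
  calc (|4 * d| : ℤ) ≤ (8 : ℝ) := by
        rw [abs_mul, abs_of_pos four_pos]
        exact_mod_cast (by linarith : 4 * |d| ≤ 8)
    _ < Real.pi ^ 2 := by nlinarith [Real.pi_gt_three]
    _ = (2 * (Real.pi / 4) * (2 ^ 2 / 2)) ^ 2 := by ring
    _ ≤ _ := by
        rw [Nat.factorial_two, Nat.cast_two]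
        gcongr

end AbsNorm

section SqrtTwo

instance : Fact (∀ r : ℚ, r ^ 2 ≠ ((2 : ℤ) : ℚ) + 0 * r) := ⟨fun r hr => by
  refine irrational_sqrt_two.ne_rat |r| ?_
  rw [Rat.cast_abs, ← Real.sqrt_sq_eq_abs]
  exact congrArg _ (by exact_mod_cast (by simpa using hr.symm : (2 : ℚ) = r ^ 2))⟩

/-- The identification of the quadratic algebra `ℚ[√2]` with the subfield `ℚ(√2)` of `ℝ`. -/
noncomputable def quadraticEquivQSqrtTwo : QuadraticAlgebra ℚ (2 : ℤ) 0 ≃ₐ[ℚ] QSqrtTwo :=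
  quadraticAlgebraEquivAdjoin ⟨√(2 : ℝ), by
    rw [Real.mul_self_sqrt zero_le_two, Algebra.smul_def, Algebra.smul_def]
    simp⟩

/-- The identification of `ℤ[√2]` with the ring of integers of `ℚ(√2)`. -/
noncomputable def ringOfIntegersEquiv : QuadraticAlgebra ℤ 2 0 ≃ₐ[ℤ] 𝓞 QSqrtTwo :=
  quadraticEquivRingOfIntegers quadraticEquivQSqrtTwo Int.prime_two.squarefree (by decide)

instance : IsPrincipalIdealRing (𝓞 QSqrtTwo) :=
  isPrincipalIdealRing_of_abs_le_two ringOfIntegersEquiv le_rfl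

end SqrtTwo

section FundamentalDomain

/-- The ring `ℤ[√2]`. -/
abbrev ZSqrtTwo : Type := QuadraticAlgebra ℤ 2 0

namespace ZSqrtTwo

lemma norm_eq (z : ZSqrtTwo) : z.norm = z.re ^ 2 - 2 * z.im ^ 2 := by
  rw [QuadraticAlgebra.norm_def]
  ring

/-- A fundamental domain for the action of the units `±(1 + √2)ᵏ` of `ℤ[√2]` on the elements of odd
norm. The boundary `2 |y| = x` contributes nothing because the norm is even there. -/
def fundamentalDomain : Set ZSqrtTwo :=
  {z | 2 * |z.im| < z.re}

lemma four_mul_im_sq_lt {z : ZSqrtTwo} (hz : z ∈ fundamentalDomain) : 4 * z.im ^ 2 < z.re ^ 2 := by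
  have h : (2 * |z.im|) ^ 2 < z.re ^ 2 := pow_lt_pow_left₀ hz (by positivity) two_ne_zero
  rwa [mul_pow, sq_abs] at h

lemma norm_pos_of_mem_fundamentalDomain {z : ZSqrtTwo} (hz : z ∈ fundamentalDomain) :
    0 < z.norm := by
  rw [norm_eq]
  nlinarith [four_mul_im_sq_lt hz, sq_nonneg z.im]

lemma star_mem_fundamentalDomain {z : ZSqrtTwo} (hz : z ∈ fundamentalDomain) :
    star z ∈ fundamentalDomain := by
  simpa [fundamentalDomain] using hz

lemma re_star_mul (z w : ZSqrtTwo) : (star z * w).re = z.re * w.re - 2 * (z.im * w.im) := by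
  simp only [QuadraticAlgebra.re_mul, QuadraticAlgebra.re_star, QuadraticAlgebra.im_star]
  ring

lemma re_star_mul_pos {z w : ZSqrtTwo} (hz : z ∈ fundamentalDomain) (hw : w ∈ fundamentalDomain) :
    0 < (star z * w).re := by
  have h : 2 * |z.im| * (2 * |w.im|) < z.re * w.re :=
    mul_lt_mul'' hz hw (by positivity) (by positivity)
  have him : z.im * w.im ≤ |z.im| * |w.im| := (le_abs_self _).trans_eq (abs_mul _ _)
  rw [re_star_mul]
  nlinarith [mul_nonneg (abs_nonneg z.im) (abs_nonneg w.im)]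

lemma re_star_mul_lt {z w : ZSqrtTwo} (hz : z ∈ fundamentalDomain) (hw : w ∈ fundamentalDomain) :
    2 * (star z * w).re < 3 * (z.norm + w.norm) := by
  rw [re_star_mul, norm_eq, norm_eq]
  nlinarith [sq_nonneg (z.re - w.re), sq_nonneg (z.im + w.im), four_mul_im_sq_lt hz,
    four_mul_im_sq_lt hw]

-- If `w = z v`, then `star z * w = N(z) v`, so the bounds on its first coordinate force
-- `0 < v.re < 3`.
lemma eq_of_associated {z w : ZSqrtTwo} (hz : z ∈ fundamentalDomain) (hw : w ∈ fundamentalDomain)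
    (h : Associated z w) : z = w := by
  obtain ⟨v, hunit, rfl⟩ : ∃ v, IsUnit v ∧ z * v = w := h.elim fun u hu => ⟨u, u.isUnit, hu⟩
  have hzpos := norm_pos_of_mem_fundamentalDomain hz
  have hwpos := norm_pos_of_mem_fundamentalDomain hw
  have hpos := re_star_mul_pos hz hw
  have hlt := re_star_mul_lt hz hw
  have hre : (star z * (z * v)).re = z.norm * v.re := by
    rw [← mul_assoc, mul_comm (star z), ← QuadraticAlgebra.algebraMap_norm_eq_mul_star]
    simp
  rw [map_mul] at hwpos hlt
  rw [hre] at hpos hlt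
  have hv : v.norm = 1 :=
    (Int.isUnit_iff.mp (QuadraticAlgebra.isUnit_iff_norm_isUnit.mp hunit)).resolve_right
      fun h => (pos_of_mul_pos_right hwpos hzpos.le).not_gt (by rw [h]; decide)
  rw [hv] at hlt
  have hv0 : 0 < v.re := pos_of_mul_pos_right hpos hzpos.le
  have hv3 : v.re < 3 := by nlinarith
  rw [norm_eq] at hv
  have hv1 : v.re = 1 := by
    interval_cases v.re
    · rfl
    · omega
  have him : v.im = 0 := by simpa [hv1] using hv
  have : v = 1 := QuadraticAlgebra.ext hv1 him
  rw [this, mul_one]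

lemma natAbs_norm_eq_of_associated {z w : ZSqrtTwo} (h : Associated z w) :
    z.norm.natAbs = w.norm.natAbs :=
  Int.associated_iff_natAbs.mp (h.map QuadraticAlgebra.norm)

lemma associated_mul_of_isUnit_norm {z v : ZSqrtTwo} (hv : IsUnit v.norm) : Associated z (z * v) :=
  ⟨(QuadraticAlgebra.isUnit_iff_norm_isUnit.mpr hv).unit, rfl⟩

lemma exists_associated_re_pos_norm_pos {z : ZSqrtTwo} (hz : z.norm ≠ 0) :
    ∃ w, Associated z w ∧ 0 < w.re ∧ 0 < w.norm := by
  obtain ⟨w, hzw, hw⟩ : ∃ w, Associated z w ∧ 0 < w.norm := by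
    rcases hz.lt_or_gt with h | h
    · have hv : QuadraticAlgebra.norm (⟨1, 1⟩ : ZSqrtTwo) = -1 := rfl
      exact ⟨z * ⟨1, 1⟩, associated_mul_of_isUnit_norm (hv ▸ isUnit_one.neg), by
        rw [map_mul, hv]; linarith⟩
    · exact ⟨z, .refl z, h⟩
  have hre : w.re ≠ 0 := fun h => by
    rw [norm_eq, h] at hw
    nlinarith
  rcases hre.lt_or_gt with h | h
  · exact ⟨-w, hzw.neg_right, by simpa using h, by rwa [QuadraticAlgebra.norm_neg]⟩
  · exact ⟨w, hzw, h, hw⟩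

lemma exists_associated_re_lt {z : ZSqrtTwo} (hre : 0 < z.re) (hpos : 0 < z.norm)
    (hodd : Odd z.norm) (hz : z ∉ fundamentalDomain) :
    ∃ w, Associated z w ∧ w.norm = z.norm ∧ 0 < w.re ∧ w.re < z.re := by
  obtain ⟨s, hs, hsim⟩ : ∃ s : ℤ, s ^ 2 = 1 ∧ s * z.im = |z.im| := by
    rcases abs_choice z.im with h | h
    · exact ⟨1, by norm_num, by rw [h, one_mul]⟩
    · exact ⟨-1, by norm_num, by rw [h, neg_one_mul]⟩
  -- Multiplication by the unit `3 - 2 s √2` turns the first coordinate `x` into `3 x - 4 |y|`.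
  have hv : QuadraticAlgebra.norm (⟨3, -2 * s⟩ : ZSqrtTwo) = 1 := by
    rw [norm_eq]
    linear_combination -8 * hs
  have hw : (z * ⟨3, -2 * s⟩).re = 3 * z.re - 4 * |z.im| := by
    rw [← hsim, QuadraticAlgebra.re_mul]
    ring
  rw [norm_eq, ← sq_abs z.im] at hpos hodd
  refine ⟨_, associated_mul_of_isUnit_norm (hv ▸ isUnit_one), by rw [map_mul, hv, mul_one], ?_, ?_⟩
  · rw [hw]
    nlinarith [abs_nonneg z.im]
  · have hne : 2 * |z.im| ≠ z.re := fun h => by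
      rw [← h] at hodd
      exact Int.not_even_iff_odd.mpr hodd ⟨|z.im| ^ 2, by ring⟩
    have hle : z.re ≤ 2 * |z.im| := not_lt.mp hz
    rw [hw]
    omega

lemma exists_associated_mem_fundamentalDomain {z : ZSqrtTwo} (hodd : Odd z.norm) :
    ∃ w ∈ fundamentalDomain, Associated z w := by
  obtain ⟨z', hzz', hre, hpos⟩ :=
    exists_associated_re_pos_norm_pos fun h : z.norm = 0 => by simp [h] at hodd
  replace hodd : Odd z'.norm := by
    rwa [← Int.natAbs_odd, ← natAbs_norm_eq_of_associated hzz', Int.natAbs_odd]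
  suffices ∃ w ∈ fundamentalDomain, Associated z' w from
    this.imp fun w hw => ⟨hw.1, hzz'.trans hw.2⟩
  clear hzz'
  induction hn : z'.re.toNat using Nat.strong_induction_on generalizing z' with
  | _ n ih =>
    by_cases hz : z' ∈ fundamentalDomain
    · exact ⟨z', hz, .refl z'⟩
    · obtain ⟨w, hzw, hnorm, hwre, hlt⟩ := exists_associated_re_lt hre hpos hodd hz
      obtain ⟨w', hw', hww'⟩ := ih _ (by omega) w hwre (hnorm ▸ hpos) (hnorm ▸ hodd) rfl
      exact ⟨w', hw', hzw.trans hww'⟩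

end ZSqrtTwo

end FundamentalDomain

section CountIdeals

namespace ZSqrtTwo

lemma ncard_absNorm_eq {m : ℕ} (hm : Odd m) :
    {I : Ideal (𝓞 QSqrtTwo) | Ideal.absNorm I = m}.ncard =
      {z | z ∈ fundamentalDomain ∧ z.norm = m}.ncard := by
  have habs (z : ZSqrtTwo) : Ideal.absNorm (Ideal.span {ringOfIntegersEquiv z}) = z.norm.natAbs :=
    absNorm_span_singleton_quadraticAlgebra_equiv ringOfIntegersEquiv z
  have hspan {z w : ZSqrtTwo} : Ideal.span {ringOfIntegersEquiv z} =
      Ideal.span {ringOfIntegersEquiv w} ↔ Associated z w := by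
    rw [Ideal.span_singleton_eq_span_singleton]
    exact ⟨fun h => by simpa using h.map ringOfIntegersEquiv.symm, .map ringOfIntegersEquiv⟩
  have hinj : {z | z ∈ fundamentalDomain ∧ z.norm = m}.InjOn
      fun z => Ideal.span {ringOfIntegersEquiv z} :=
    fun z hz w hw h => eq_of_associated hz.1 hw.1 (hspan.mp h)
  rw [← hinj.ncard_image]
  congr 1
  ext I
  refine ⟨fun hI => ?_, ?_⟩
  · obtain ⟨a, rfl⟩ := (IsPrincipalIdealRing.principal I).principal
    obtain ⟨z, rfl⟩ := ringOfIntegersEquiv.surjective a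
    have hz : z.norm.natAbs = m := (habs z).symm.trans hI
    obtain ⟨w, hw, hzw⟩ := exists_associated_mem_fundamentalDomain
      (Int.natAbs_odd.mp (hz ▸ hm))
    refine ⟨w, ⟨hw, ?_⟩, (hspan.mpr hzw).symm⟩
    rw [natAbs_norm_eq_of_associated hzw] at hz
    rw [← hz, Int.natAbs_of_nonneg (norm_pos_of_mem_fundamentalDomain hw).le]
  · rintro ⟨z, ⟨-, hz⟩, rfl⟩
    simp [habs, hz]

/-- The element of `ℤ[√2]` with coordinates `x = 4 n + s` and `y = 2 k + 1` for the pair `(k, a)`,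
where `n = k + 1 + a`. For `s = ∓1` its norm is `8 e - 1`, where `e = 2 n ^ 2 ∓ n - k (k + 1)` is an
exponent of the indefinite theta series. -/
def thetaPoint (s : ℤ) (x : ℕ × ℕ) : ZSqrtTwo :=
  ⟨4 * (x.1 + 1 + x.2) + s, 2 * x.1 + 1⟩

lemma thetaPoint_injective (s : ℤ) : Function.Injective (thetaPoint s) := by
  rintro ⟨k, a⟩ ⟨l, b⟩ h
  simp only [thetaPoint, QuadraticAlgebra.ext_iff] at h
  ext <;> dsimp only <;> omega

lemma norm_thetaPoint_neg_one (x : ℕ × ℕ) : (thetaPoint (-1) x).norm = 8 * thetaExp x - 1 := by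
  simp only [norm_eq, thetaPoint, thetaExp]
  push_cast
  ring

lemma norm_thetaPoint_one (x : ℕ × ℕ) :
    (thetaPoint 1 x).norm = 8 * (thetaExp x + 2 * (x.1 + 1 + x.2) : ℕ) - 1 := by
  simp only [norm_eq, thetaPoint, thetaExp]
  push_cast
  ring

lemma thetaPoint_mem {s : ℤ} (hs : -1 ≤ s) (x : ℕ × ℕ) : thetaPoint s x ∈ fundamentalDomain := by
  have h : |(2 * x.1 + 1 : ℤ)| = 2 * x.1 + 1 := abs_of_nonneg (by positivity)
  simp only [fundamentalDomain, thetaPoint, Set.mem_ofPred_eq, h]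
  omega

lemma odd_re_of_norm_eq {z : ZSqrtTwo} {d : ℤ} (hnorm : z.norm = 8 * d - 1) : Odd z.re := by
  rw [norm_eq] at hnorm
  have : Odd (z.re ^ 2) := ⟨z.im ^ 2 + 4 * d - 1, by linarith⟩
  exact (Int.odd_pow' two_ne_zero).mp this

lemma odd_im_of_norm_eq {z : ZSqrtTwo} {d : ℤ} (hnorm : z.norm = 8 * d - 1) : Odd z.im := by
  obtain ⟨r, hr⟩ := odd_re_of_norm_eq hnorm
  rw [norm_eq, hr] at hnorm
  have : Odd (z.im ^ 2) := ⟨r ^ 2 + r - 2 * d, by linarith⟩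
  exact (Int.odd_pow' two_ne_zero).mp this

lemma exists_thetaPoint_eq {z : ZSqrtTwo} (hz : z ∈ fundamentalDomain) (him : 0 < z.im) {d : ℤ}
    (hnorm : z.norm = 8 * d - 1) : ∃ x, thetaPoint (-1) x = z ∨ thetaPoint 1 x = z := by
  obtain ⟨y, hy⟩ : Odd z.im := odd_im_of_norm_eq hnorm
  obtain ⟨n, hn⟩ : ∃ n, z.re = 4 * n - 1 ∨ z.re = 4 * n + 1 := by
    obtain ⟨r, hr⟩ := odd_re_of_norm_eq hnorm
    exact ⟨(r + 1) / 2, by omega⟩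
  have hlt : 2 * z.im < z.re := abs_of_pos him ▸ hz
  refine ⟨(y.toNat, (n - 1 - y).toNat), hn.imp (fun h => ?_) (fun h => ?_)⟩ <;>
    ext <;> simp only [thetaPoint] <;> omega

lemma setOf_im_pos_eq (d : ℕ) :
    {z | z ∈ fundamentalDomain ∧ z.norm = 8 * d - 1 ∧ 0 < z.im} =
      thetaPoint (-1) '' {x | thetaExp x = d} ∪
        thetaPoint 1 '' {x | thetaExp x + 2 * (x.1 + 1 + x.2) = d} := by
  ext z
  constructor
  · rintro ⟨hz, hnorm, him⟩
    obtain ⟨x, rfl | rfl⟩ := exists_thetaPoint_eq hz him hnorm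
    · rw [norm_thetaPoint_neg_one] at hnorm
      exact .inl ⟨x, by rw [Set.mem_ofPred_eq]; omega, rfl⟩
    · rw [norm_thetaPoint_one] at hnorm
      exact .inr ⟨x, by rw [Set.mem_ofPred_eq]; omega, rfl⟩
  · have him (s : ℤ) (x : ℕ × ℕ) : 0 < (thetaPoint s x).im := by
      simp only [thetaPoint]
      positivity
    rintro (⟨x, rfl, rfl⟩ | ⟨x, rfl, rfl⟩)
    · exact ⟨thetaPoint_mem le_rfl x, norm_thetaPoint_neg_one x, him _ x⟩
    · exact ⟨thetaPoint_mem (by norm_num) x, norm_thetaPoint_one x, him _ x⟩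

lemma disjoint_thetaPoint_image (s t : Set (ℕ × ℕ)) :
    Disjoint (thetaPoint (-1) '' s) (thetaPoint 1 '' t) := by
  rw [Set.disjoint_left]
  rintro _ ⟨x, -, rfl⟩ ⟨y, -, h⟩
  have := congrArg QuadraticAlgebra.re h
  simp only [thetaPoint] at this
  omega

lemma setOf_norm_eq_union_star (d : ℕ) :
    {z | z ∈ fundamentalDomain ∧ z.norm = 8 * d - 1} =
      {z | z ∈ fundamentalDomain ∧ z.norm = 8 * d - 1 ∧ 0 < z.im} ∪
        star '' {z | z ∈ fundamentalDomain ∧ z.norm = 8 * d - 1 ∧ 0 < z.im} := by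
  ext z
  constructor
  · rintro ⟨hz, hnorm⟩
    have him : z.im ≠ 0 := fun h => by simpa [h] using odd_im_of_norm_eq hnorm
    rcases him.lt_or_gt with h | h
    · exact .inr ⟨star z, ⟨star_mem_fundamentalDomain hz, by rwa [QuadraticAlgebra.norm_star],
        by simpa using h⟩, star_star z⟩
    · exact .inl ⟨hz, hnorm, h⟩
  · rintro (⟨hz, hnorm, -⟩ | ⟨z, ⟨hz, hnorm, -⟩, rfl⟩)
    · exact ⟨hz, hnorm⟩
    · exact ⟨star_mem_fundamentalDomain hz, by rwa [QuadraticAlgebra.norm_star]⟩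

lemma ncard_norm_eq (d : ℕ) :
    {z | z ∈ fundamentalDomain ∧ z.norm = 8 * d - 1}.ncard =
      2 * ({x | thetaExp x = d}.ncard + {x | thetaExp x + 2 * (x.1 + 1 + x.2) = d}.ncard) := by
  have hA := (finite_thetaExp_eq d).image (thetaPoint (-1))
  have hB := (finite_thetaExp_add_eq d).image (thetaPoint 1)
  have hfin := hA.union hB
  have hcard := Set.ncard_union_eq (disjoint_thetaPoint_image _ _) hA hB
  rw [Set.ncard_image_of_injective _ (thetaPoint_injective _),
    Set.ncard_image_of_injective _ (thetaPoint_injective _)] at hcard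
  rw [← setOf_im_pos_eq] at hfin hcard
  have hdisj : Disjoint {z : ZSqrtTwo | z ∈ fundamentalDomain ∧ z.norm = 8 * d - 1 ∧ 0 < z.im}
      (star '' {z | z ∈ fundamentalDomain ∧ z.norm = 8 * d - 1 ∧ 0 < z.im}) := by
    rw [Set.disjoint_left]
    rintro _ ⟨-, -, h⟩ ⟨z, ⟨-, -, him⟩, rfl⟩
    rw [QuadraticAlgebra.im_star] at h
    omega
  rw [setOf_norm_eq_union_star, Set.ncard_union_eq hdisj hfin (hfin.image _),
    Set.ncard_image_of_injective _ star_injective, hcard, two_mul]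

end ZSqrtTwo

end CountIdeals

section Main

lemma two_mul_OStar_eq {m d : ℕ} (h : m + 1 = 8 * d) :
    2 * OStar d = (-1) ^ d * {I : Ideal (𝓞 QSqrtTwo) | Ideal.absNorm I = m}.ncard := by
  have hm : (m : ℤ) = 8 * d - 1 := by omega
  rw [ZSqrtTwo.ncard_absNorm_eq (by rw [Nat.odd_iff]; omega), hm, ZSqrtTwo.ncard_norm_eq,
    OStar_eq_ncard]
  push_cast
  ring

lemma hasSum_OStar :
    HasSum (fun n : ℕ+ => PowerSeries.C (OStar n) * (PowerSeries.X : ℤ⟦X⟧) ^ (8 * (n : ℕ)))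
      (PowerSeries.mk fun m => {n : ℕ+ | 8 * (n : ℕ) = m}.ncard • OStar (m / 8)) := by
  refine hasSum_of_eq (hasSum_C_mul_X_pow (fun n : ℕ+ => 8 * (n : ℕ)) (fun m => ?_)
    fun m => OStar (m / 8)) (fun n => ?_) rfl
  · refine Set.Subsingleton.finite fun n hn k hk => PNat.eq ?_
    simp only [Set.mem_ofPred_eq] at hn hk
    omega
  · rw [Nat.mul_div_cancel_left _ (by norm_num)]

lemma hasSum_absNorm :
    HasSum (fun a : NormNegOneIdeal =>
        (-1) ^ ((Ideal.absNorm a.1 + 1) / 8) * (PowerSeries.X : ℤ⟦X⟧) ^ Ideal.absNorm a.1)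
      (PowerSeries.mk fun m =>
        {a : NormNegOneIdeal | Ideal.absNorm a.1 = m}.ncard • (-1) ^ ((m + 1) / 8)) := by
  refine hasSum_of_eq (hasSum_C_mul_X_pow (fun a : NormNegOneIdeal => Ideal.absNorm a.1)
    (fun m => (Ideal.finite_setOfPred_absNorm_eq m).preimage Subtype.val_injective.injOn)
    fun m => (-1) ^ ((m + 1) / 8)) (fun a => ?_) rfl
  simp

lemma ncard_eight_mul_eq (m : ℕ) :
    {n : ℕ+ | 8 * (n : ℕ) = m + 1}.ncard = if 8 ∣ m + 1 then 1 else 0 := by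
  split_ifs with h
  · obtain ⟨d, hd⟩ := h
    refine Set.ncard_eq_one.mpr ⟨⟨d, by omega⟩, Set.eq_singleton_iff_unique_mem.mpr ⟨hd.symm, ?_⟩⟩
    refine fun n hn => PNat.eq (Nat.eq_of_mul_eq_mul_left (by norm_num : 0 < 8) ?_)
    exact hn.trans hd
  · refine (congrArg _ (Set.eq_empty_iff_forall_notMem.mpr ?_)).trans (Set.ncard_empty _)
    exact fun n hn => h ⟨n, Eq.symm hn⟩

lemma ncard_normNegOneIdeal_absNorm_eq (m : ℕ) :
    {a : NormNegOneIdeal | Ideal.absNorm a.1 = m}.ncard =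
      if 8 ∣ m + 1 then {I : Ideal (𝓞 QSqrtTwo) | Ideal.absNorm I = m}.ncard else 0 := by
  split_ifs with h
  · rw [← Set.ncard_image_of_injective _ Subtype.val_injective]
    congr 1
    ext I
    refine ⟨fun ⟨_, ha, hI⟩ => hI ▸ ha, fun hI => ⟨⟨I, ?_⟩, hI, rfl⟩⟩
    rw [Set.mem_ofPred_eq] at hI
    rw [hI, Int.modEq_iff_dvd]
    omega
  · refine (congrArg _ (Set.eq_empty_iff_forall_notMem.mpr ?_)).trans (Set.ncard_empty _)
    rintro ⟨I, hI⟩ (ha : Ideal.absNorm I = m)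
    rw [ha, Int.modEq_iff_dvd] at hI
    omega

lemma two_mul_mk_eq_X_mul_mk :
    2 * (PowerSeries.mk fun m => {n : ℕ+ | 8 * (n : ℕ) = m}.ncard • OStar (m / 8)) =
      PowerSeries.X * PowerSeries.mk fun m =>
        {a : NormNegOneIdeal | Ideal.absNorm a.1 = m}.ncard • (-1 : ℤ) ^ ((m + 1) / 8) := by
  rw [← map_ofNat PowerSeries.C 2]
  ext m
  rw [PowerSeries.coeff_C_mul, PowerSeries.coeff_mk]
  cases m with
  | zero => simp
  | succ m =>
    rw [PowerSeries.coeff_succ_X_mul, PowerSeries.coeff_mk, ncard_eight_mul_eq,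
      ncard_normNegOneIdeal_absNorm_eq]
    split_ifs with h
    · obtain ⟨d, hd⟩ := h
      rw [hd, Nat.mul_div_cancel_left _ (by norm_num), one_smul, two_mul_OStar_eq hd, nsmul_eq_mul,
        mul_comm]
    · rw [zero_smul, zero_smul, mul_zero]

end Main

/-- An identity of formal Laurent series in `q` with integer coefficients. The two infinite sums
are taken in `ℤ⟦q⟧` with its coefficientwise topology (`ℤ` being discrete), and both converge. -/
theorem corollary3p6 :
    Summable (fun n : ℕ+ => PowerSeries.C (OStar n) * (PowerSeries.X : ℤ⟦X⟧) ^ (8 * (n : ℕ))) ∧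
    Summable (fun a : NormNegOneIdeal =>
      (-1) ^ ((Ideal.absNorm a.1 + 1) / 8) * (PowerSeries.X : ℤ⟦X⟧) ^ Ideal.absNorm a.1) ∧
    2 * HahnSeries.single (-1 : ℤ) (1 : ℤ) *
        ((∑' n : ℕ+, PowerSeries.C (OStar n) * (PowerSeries.X : ℤ⟦X⟧) ^ (8 * (n : ℕ)) : ℤ⟦X⟧) :
          ℤ⸨X⸩) =
      ((∑' a : NormNegOneIdeal,
        (-1) ^ ((Ideal.absNorm a.1 + 1) / 8) * (PowerSeries.X : ℤ⟦X⟧) ^ Ideal.absNorm a.1 :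
          ℤ⟦X⟧) : ℤ⸨X⸩) := by
  refine ⟨hasSum_OStar.summable, hasSum_absNorm.summable, ?_⟩
  rw [hasSum_OStar.tsum_eq, hasSum_absNorm.tsum_eq]
  have h := congrArg (HahnSeries.ofPowerSeries ℤ ℤ) two_mul_mk_eq_X_mul_mk
  rw [map_mul, map_mul, map_ofNat, HahnSeries.ofPowerSeries_X] at h
  rw [mul_comm 2, mul_assoc, h, ← mul_assoc, HahnSeries.single_mul_single]
  simp
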